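/- Let $P$ be a finite poset with underlying set $V$. Let $\mathrm{inc}(P)$ be its incomparability graph (vertex set $V$, with an edge between $v$ and $w$ if and only if $v$ and $w$ are incomparable), and let $$X_{\mathrm{inc}(P)}=\sum_{\sigma}\tilde m_{t(\sigma)}$$ be its chromatic symmetric function. Here $\sigma$ runs over all set partitions of $V$ into blocks that contain no edge of $\mathrm{inc}(P)$, $t(\sigma)$ is the integer partition whose parts are the block sizes of $\sigma$, and $\tilde m_\mu=(r_1!\,r_2!\cdots)\,m_\mu$, where $m_\mu$ is the monomial symmetric function and $r_i$ is the number of parts of $\mu$ equal to $i$. Let $\overline P$ be the digraph on $V$ with an arrow from $v$ to $w$ (loops $v=w$ included) if and only if $v\not<w$. A weakly decreasing path cover of $P$ is a spanning subdigraph $E\subseteq\overline P$ each of whose connected components is a directed path (an isolated vertex being allowed as a path); its type $t(E)$ is the integer partition whose parts are the numbers of vertices of the components of $E$. Let $\overline P/E$ be the digraph whose vertices are the components of $E$, with an arrow from $C$ to $C'$ (possibly $C=C'$) if and only if $\overline P$ has an arrow from the last vertex of the path $C$ to the first vertex of the path $C'$. Then $X_{\mathrm{inc}(P)}$ has a unique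 expansion as a finite integral linear combination of the elementary symmetric functions $e_\lambda$ ($\lambda$ running over all integer partitions), and for every integer partition $\lambda$ the coefficient of $e_\lambda$ in it is $$\sum_{\substack{E\subseteq\overline P\\ t(E)=\lambda}}\det(\overline P/E),$$ where the sum is over all weakly decreasing path covers $E$ of $P$ of type $\lambda$ and $\det(\overline P/E)$ is the determinant of the adjacency matrix of $\overline P/E$. -/

import Mathlib

namespace ChromaticDet

/-! ### Symmetric functions, as formal power series over `ℤ` in the variables `x₀, x₁, x₂, …` -/

/-- Formal power series over `ℤ` in countably many variables, the home of symmetric functions. -/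
abbrev Series : Type := MvPowerSeries ℕ ℤ

open Classical in
/-- The elementary symmetric function `e_k`, the sum of all squarefree monomials of degree `k`. -/
noncomputable def elem (k : ℕ) : Series := fun d : ℕ →₀ ℕ =>
  if (∀ i, d i ≤ 1) ∧ d.degree = k then 1 else 0

/-- `e_μ`, the product of the `e_k` over the parts `k` of `μ`. -/
noncomputable def elemPart {n : ℕ} (μ : n.Partition) : Series :=
  (μ.parts.map elem).prod

open Classical in
/-- The monomial symmetric function `m_μ`, the sum of all distinct monomials whose multiset of
nonzero exponents is `μ`. -/
noncomputable def monom {n : ℕ} (μ : n.Partition) : Series := fun d : ℕ →₀ ℕ =>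
  if d.support.val.map d = μ.parts then 1 else 0

/-- The augmented monomial symmetric function `(r₁! r₂! ⋯) m_μ`, where `r_i` is the number of
parts of `μ` that are equal to `i`. -/
noncomputable def augMonom {n : ℕ} (μ : n.Partition) : Series :=
  (∏ i ∈ μ.parts.toFinset, (μ.parts.count i).factorial) • monom μ

/-- `c` is a (finitely supported, integral) family of coefficients of an expansion of `f` in the
functions `e_μ`, where `μ` runs through all integer partitions of all sizes. -/
def IsElemExpansion (f : Series) (c : (Σ n : ℕ, n.Partition) →₀ ℤ) : Prop :=
  f = c.sum fun μ a => a • elemPart μ.2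

/-! ### The chromatic symmetric function -/

section Chromatic

variable {V : Type*} [Fintype V]

/-- The integer partition formed by the block sizes of a set partition of `V`. -/
def blockType [DecidableEq V] (σ : Finpartition (Finset.univ : Finset V)) :
    (Fintype.card V).Partition where
  parts := σ.parts.val.map Finset.card
  parts_pos := by
    intro i hi
    obtain ⟨b, hb, rfl⟩ := Multiset.mem_map.1 hi
    exact Finset.card_pos.2 (σ.nonempty_of_mem_parts hb)
  parts_sum := σ.sum_card_parts

open Classical in
/-- The chromatic symmetric function of a finite graph: the sum of the augmented monomial symmetric
functions of the types of all partitions of the vertex set into stable (independent) blocks. -/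
noncomputable def chromaticSymm (G : SimpleGraph V) : Series :=
  ∑ σ : Finpartition (Finset.univ : Finset V) with ∀ b ∈ σ.parts, G.IsIndepSet (SetLike.coe b),
    augMonom (blockType σ)

end Chromatic

/-! ### Digraphs, path covers, contraction -/

section Digraphs

variable {V : Type*}

/-- Two vertices are in the same connected component if they are joined by a sequence of arrows
used in either direction. -/
def componentSetoid (E : Digraph V) : Setoid V := Relation.EqvGen.setoid E.Adj

/-- The connected components of a digraph. -/
def Component (E : Digraph V) : Type _ := Quotient (componentSetoid E)

/-- The component of a vertex. -/
def component (E : Digraph V) (v : V) : Component E := Quotient.mk (componentSetoid E) v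

/-- The component `C` of `E` is a directed path: the restriction of `E` to it is isomorphic to the
digraph on `0, 1, …, m - 1` whose arrows are the pairs `(i, i + 1)`. -/
def IsPathComponent (E : Digraph V) (C : Component E) : Prop :=
  ∃ (m : ℕ) (f : Fin m ≃ {v : V // component E v = C}),
    ∀ i j : Fin m, E.Adj (f i) (f j) ↔ (i : ℕ) + 1 = (j : ℕ)

/-- `E` is a path cover of `D`: a spanning subdigraph all of whose components are paths. -/
def IsPathCover (D E : Digraph V) : Prop :=
  E ≤ D ∧ ∀ C : Component E, IsPathComponent E C

/-- The contraction `D / E` (for a path cover `E`): its vertices are the components of `E`, with an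
arrow from `C` to `C'` if and only if `D` has an arrow from the end of the path `C` to the beginning
of the path `C'`. The end (beginning) of a path is its vertex with no arrow pointing from (to) it. -/
def contraction (D E : Digraph V) : Digraph (Component E) where
  Adj C C' := ∃ v w : V, component E v = C ∧ (∀ u, ¬ E.Adj v u) ∧
    component E w = C' ∧ (∀ u, ¬ E.Adj u w) ∧ D.Adj v w

open Classical in
/-- The adjacency matrix of a digraph. -/
noncomputable def adjacencyMatrix (D : Digraph V) : Matrix V V ℤ :=
  Matrix.of fun v w => if D.Adj v w then 1 else 0

variable [Fintype V]

open Classical in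
noncomputable instance (E : Digraph V) : Fintype (Component E) :=
  Fintype.ofSurjective (component E) Quotient.mk_surjective

open Classical in
/-- The type of a digraph: the integer partition formed by the numbers of vertices of its
components. -/
noncomputable def digraphType (E : Digraph V) : (Fintype.card V).Partition where
  parts := (Finset.univ : Finset (Component E)).val.map
    fun C => Fintype.card {v : V // component E v = C}
  parts_pos := by
    intro i hi
    obtain ⟨C, -, rfl⟩ := Multiset.mem_map.1 hi
    obtain ⟨v, hv⟩ := Quotient.mk_surjective C
    exact Fintype.card_pos_iff.2 ⟨⟨v, hv⟩⟩
  parts_sum := by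
    change ∑ C : Component E, Fintype.card {v : V // component E v = C} = _
    rw [← Fintype.card_sigma]
    exact Fintype.card_congr (Equiv.sigmaFiberEquiv (component E))

open Classical in
/-- The path covers of `D` of type `μ`. -/
noncomputable def pathCovers (D : Digraph V) {n : ℕ} (μ : n.Partition) : Finset (Digraph V) :=
  {E : Digraph V | IsPathCover D E ∧ (digraphType E).parts = μ.parts}

open Classical in
/-- The determinant of the adjacency matrix of a finite digraph. -/
noncomputable def digraphDet (D : Digraph V) : ℤ := (adjacencyMatrix D).det

end Digraphs

/-! ### Posets -/

section Posets

variable (P : Type*) [PartialOrder P]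

/-- The digraph of a poset, with an arrow from `v` to `w` if and only if `v < w`. -/
def posetDigraph : Digraph P where
  Adj v w := v < w

/-- The incomparability graph of a poset. -/
def incGraph : SimpleGraph P where
  Adj v w := IncompRel (· ≤ ·) v w
  symm := ⟨fun _ _ h => h.symm⟩
  loopless := ⟨fun _ h => h.1 le_rfl⟩

/-- The complement of the digraph of a poset: there is an arrow from `v` to `w` if and only if `v`
is not less than `w`. Its path covers are the weakly decreasing path covers of the poset. -/
def weaklyDecreasing : Digraph P := (posetDigraph P)ᶜ

end Posets

end ChromaticDet

/-! The proof compares the coefficients of each monomial. In the chromatic symmetric function such a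
coefficient counts the proper colourings `κ` with a given content, and `κ` is proper for the
incomparability graph exactly when its fibres are chains. In an elementary symmetric function of the
type of a path cover `E`, it counts the colourings that strictly increase along the arrows of `E`.
So it suffices to prove, for each single `κ`, that the indicator of "all fibres are chains" is the
sum of det(D/E) over the covers `E` along which `κ` increases, where D is the digraph of `¬ v < w`.

Both sides equal the determinant of the adjacency matrix of D with the `κ`-increasing arrows
deleted. On one side, this matrix is block triangular in the colours, and the block of a fibre has
determinant 1 or 0 according to whether the fibre is a chain (`det_not_lt`, `det_not_lt_and_le`). On
the other side, each deleted entry is written as −1 + 1 and the Leibniz sum is expanded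
(`det_nonincreasing_eq_sum`). The arrows at which −1 is chosen form a partial injection; since `κ`
increases along them they close no cycle, hence form a path cover `E`. The terms belonging to `E`
add up to the determinant of `coverMatrix`, which is det(D/E) by `digraphDet_contraction`.

Uniqueness of the expansion is the linear independence of the elementary products, reduced to the
algebraic independence of elementary symmetric polynomials in finitely many variables. -/

namespace ChromaticDet

/-! ### Determinants that detect chains -/

/-- The determinant of the matrix of the relation `¬ v < w` of a finite poset detects chains. -/
theorem det_not_lt (Q : Type*) [PartialOrder Q] [Fintype Q] [DecidableEq Q]
    (M : Matrix Q Q ℤ) (h0 : ∀ v w, v < w → M v w = 0) (h1 : ∀ v w, ¬ v < w → M v w = 1)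
    [Decidable (∀ v w : Q, v ≤ w ∨ w ≤ v)] :
    M.det = if ∀ v w : Q, v ≤ w ∨ w ≤ v then 1 else 0 := by
  classical
  split_ifs with h
  · have := h
    let _ : LinearOrder Q :=
      { ‹PartialOrder Q› with
        le_total := h
        toDecidableLE := Classical.decRel _
        toDecidableEq := inferInstance }
    have hM : M.BlockTriangular OrderDual.toDual := fun i j hij => h0 i j hij
    rw [show M.det = ∏ i, M i i by convert Matrix.det_of_isLowerTriangular M hM]
    exact Finset.prod_eq_one fun i _ => h1 i i (lt_irrefl i)
  · push Not at h
    obtain ⟨a, b, hab, hba⟩ := h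
    let S : Set (Q × Q) := {p | ¬ p.1 ≤ p.2 ∧ ¬ p.2 ≤ p.1}
    -- Sizes of principal up-sets: an incomparable pair with the smallest total size is, informally,
    -- as high in the poset as possible.
    let up : Q → ℕ := fun v => (Finset.univ.filter fun u => v ≤ u).card
    have hup : ∀ v u, v < u → up u < up v := fun v u huv => by
      apply Finset.card_lt_card
      rw [Finset.ssubset_iff_of_subset]
      · exact ⟨v, by simp, by simpa using huv.not_ge⟩
      · intro x hx
        simp only [Finset.mem_filter, Finset.mem_univ, true_and] at hx ⊢
        exact huv.le.trans hx
    let f : Q × Q → ℕ := fun p => up p.1 + up p.2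
    have hS : S.Nonempty := ⟨(a, b), hab, hba⟩
    obtain ⟨⟨v, w⟩, ⟨hvw, hwv⟩, hmin⟩ :=
      WellFounded.has_min (measure f).wf S hS
    -- An element above only one member of the pair would be incomparable to the other and give a
    -- smaller pair. So both members have the same strict upper bounds, and their rows coincide.
    have key : ∀ u, v < u ↔ w < u := by
      intro u
      constructor
      · intro hu
        by_contra hwu
        have h1 : ¬ u ≤ w := fun h => hvw (hu.le.trans h)
        have h2 : ¬ w ≤ u := fun h => hwu (lt_of_le_of_ne h fun e => hvw (e ▸ hu.le))
        have := hmin (u, w) ⟨h1, h2⟩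
        exact this (Nat.add_lt_add_right (hup v u hu) _)
      · intro hu
        by_contra hvu
        have h1 : ¬ u ≤ v := fun h => hwv (hu.le.trans h)
        have h2 : ¬ v ≤ u := fun h => hvu (lt_of_le_of_ne h fun e => hwv (e ▸ hu.le))
        have := hmin (v, u) ⟨h2, h1⟩
        exact this (Nat.add_lt_add_left (hup w u hu) _)
    refine Matrix.det_zero_of_row_eq (i := v) (j := w) (fun e => hvw e.le) ?_
    funext u
    by_cases hu : v < u
    · rw [h0 v u hu, h0 w u ((key u).1 hu)]
    · rw [h1 v u hu, h1 w u (fun h => hu ((key u).2 h))]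

/-- For a map `κ` on a finite poset, the matrix of the relation `¬ v < w ∧ κ w ≤ κ v` has
determinant `1` if all fibres of `κ` are chains, and `0` otherwise. -/
theorem det_not_lt_and_le (Q : Type*) [PartialOrder Q] [Fintype Q] [DecidableEq Q] (κ : Q → ℕ)
    (M : Matrix Q Q ℤ) (h0 : ∀ v w, (v < w ∨ κ v < κ w) → M v w = 0)
    (h1 : ∀ v w, ¬ v < w → κ w ≤ κ v → M v w = 1)
    [Decidable (∀ v w : Q, κ v = κ w → v ≤ w ∨ w ≤ v)] :
    M.det = if ∀ v w : Q, κ v = κ w → v ≤ w ∨ w ≤ v then 1 else 0 := by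
  classical
  -- An entry vanishes when the colour increases from row to column, hence triangularity for the
  -- reversed order of colours. The diagonal blocks belong to the fibres of `κ`.
  let b : Q → ℕᵒᵈ := fun v => OrderDual.toDual (κ v)
  have hM : M.BlockTriangular b := fun i j hij => h0 i j (Or.inr hij)
  rw [hM.det]
  have hblock : ∀ a, (M.toSquareBlock b a).det =
      if ∀ v w : {v // b v = a}, v ≤ w ∨ w ≤ v then 1 else 0 := fun a =>
    det_not_lt {v // b v = a} _ (fun v w h => h0 v w (Or.inl h))
      (fun v w h => h1 v w h (OrderDual.toDual.injective (v.2.trans w.2.symm)).ge)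
  simp_rw [hblock]
  split_ifs with h
  · refine Finset.prod_eq_one fun a _ =>
      if_pos fun (v w : {v // b v = a}) =>
        h v.1 w.1 (OrderDual.toDual.injective (v.2.trans w.2.symm))
  · push Not at h
    obtain ⟨v, w, hvw, h2, h3⟩ := h
    refine Finset.prod_eq_zero (i := b v) (Finset.mem_image_of_mem _ (Finset.mem_univ _)) ?_
    refine if_neg fun h => ?_
    have hw : b w = b v := congrArg OrderDual.toDual hvw.symm
    exact (h ⟨v, rfl⟩ ⟨w, hw⟩).elim h2 h3

/-! ### Contracting blocks in a determinant -/

/-- Both sides are homomorphisms in `F`, so it is enough to compare them on families that are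
trivial outside one index. -/
theorem sign_sigmaCongrRight {ι : Type*} [Fintype ι] [DecidableEq ι] {β : ι → Type*}
    [∀ i, Fintype (β i)] [∀ i, DecidableEq (β i)] (F : ∀ i, Equiv.Perm (β i)) :
    Equiv.Perm.sign (Equiv.Perm.sigmaCongrRight F) = ∏ i, Equiv.Perm.sign (F i) := by
  let S : (∀ i, Equiv.Perm (β i)) →* ℤˣ :=
    Equiv.Perm.sign.comp (Equiv.Perm.sigmaCongrRightHom β)
  let T : (∀ i, Equiv.Perm (β i)) →* ℤˣ :=
    { toFun := fun F => ∏ i, Equiv.Perm.sign (F i)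
      map_one' := by simp
      map_mul' := fun F G => by simp [Finset.prod_mul_distrib] }
  suffices S = T from DFunLike.congr_fun this F
  refine MonoidHom.pi_ext fun i σ => ?_
  have hT : T (Pi.mulSingle i σ) = Equiv.Perm.sign σ := by
    change ∏ j, Equiv.Perm.sign (Pi.mulSingle (M := fun i => Equiv.Perm (β i)) i σ j) = _
    rw [Finset.prod_eq_single i (fun j _ hj => by rw [Pi.mulSingle_eq_of_ne hj, map_one])
      (by simp), Pi.mulSingle_eq_same]
  rw [hT]
  have happ : ∀ j (x : β j), Equiv.Perm.sigmaCongrRight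
      (Pi.mulSingle (M := fun i => Equiv.Perm (β i)) i σ) ⟨j, x⟩ =
      ⟨j, Pi.mulSingle (M := fun i => Equiv.Perm (β i)) i σ j x⟩ := fun _ _ => rfl
  symm
  refine Equiv.Perm.sign_bij (fun x _ => (⟨i, x⟩ : Σ i, β i)) ?_ ?_ ?_
  · intro x _ _
    change _ = Equiv.Perm.sigmaCongrRight _ _
    rw [happ, Pi.mulSingle_eq_same]
  · intro x y _ _ h
    simpa using h
  · rintro ⟨j, x⟩ hx
    by_cases hj : j = i
    · subst hj
      refine ⟨x, fun h => hx ?_, rfl⟩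
      change Equiv.Perm.sigmaCongrRight _ _ = _
      rw [happ, Pi.mulSingle_eq_same, h]
    · refine absurd ?_ hx
      change Equiv.Perm.sigmaCongrRight _ _ = _
      rw [happ, Pi.mulSingle_eq_of_ne hj, Equiv.Perm.one_apply]

/-- Contraction of paths in a determinant: if every row but the last one of each block is minus the
unit vector of the next index, then only the rows at the ends and the columns at the beginnings
of the blocks matter. -/
theorem det_eq_det_ends {ι : Type*} [Fintype ι] [DecidableEq ι] (l : ι → ℕ)
    (M : Matrix (Σ i, Fin (l i + 1)) (Σ i, Fin (l i + 1)) ℤ)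
    (hM : ∀ (i : ι) (j : Fin (l i + 1)), j ≠ Fin.last _ → ∀ k,
      M ⟨i, j⟩ k = if k = ⟨i, finRotate _ j⟩ then -1 else 0) :
    M.det = (Matrix.of fun i i' => M ⟨i, Fin.last _⟩ ⟨i', 0⟩).det := by
  classical
  let c : Equiv.Perm (Σ i, Fin (l i + 1)) := Equiv.Perm.sigmaCongrRight fun i => finRotate (l i + 1)
  have hc : ∀ i j, c ⟨i, j⟩ = ⟨i, finRotate _ j⟩ := fun i j => rfl
  have hsign : (Equiv.Perm.sign c : ℤ) = (-1) ^ ∑ i, l i := by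
    rw [sign_sigmaCongrRight]
    simp [sign_finRotate, Finset.prod_pow_eq_pow_sum]
  let p : (Σ i, Fin (l i + 1)) → Prop := fun x => x.2 = Fin.last _
  -- Rotating the columns of each block moves the −1 of every non-last row onto the diagonal and
  -- column 0 to the last position. The non-last rows then contribute the determinant of −1, which
  -- cancels the sign of `c`.
  set M' := M.submatrix id c with hM'
  have hdet : M'.det = (-1) ^ (∑ i, l i) * M.det := by
    rw [hM', Matrix.det_permute']
    exact congrArg (· * M.det) hsign
  have htri : ∀ x, ¬ p x → ∀ y, M' x y = if x = y then -1 else 0 := by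
    rintro ⟨i, j⟩ hx y
    rw [hM', Matrix.submatrix_apply, id, hM i j hx, ← hc]
    simp only [c.injective.eq_iff, eq_comm]
  have h2 := M'.twoBlockTriangular_det p fun x hx y hy => by
    rw [htri x hx, if_neg]
    rintro rfl
    exact hx hy
  let e : ι ≃ {x // p x} :=
    { toFun := fun i => ⟨⟨i, Fin.last _⟩, rfl⟩
      invFun := fun x => x.1.1
      left_inv := fun i => rfl
      right_inv := by
        rintro ⟨⟨i, j⟩, h⟩
        have : j = Fin.last _ := h
        subst this
        rfl }
  have hlast : (M'.toSquareBlockProp p).det =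
      (Matrix.of fun i i' => M ⟨i, Fin.last _⟩ ⟨i', 0⟩).det := by
    rw [← Matrix.det_submatrix_equiv_self e]
    congr 1
    ext i i'
    change M ⟨i, Fin.last _⟩ (c ⟨i', Fin.last _⟩) = _
    rw [hc, finRotate_last]
    rfl
  have hcard : Fintype.card {x // ¬ p x} = ∑ i, l i := by
    rw [Fintype.card_subtype_compl, ← Fintype.card_congr e]
    simp [Finset.sum_add_distrib]
  have hrest : (M'.toSquareBlockProp fun x => ¬ p x).det = (-1) ^ ∑ i, l i := by
    have : M'.toSquareBlockProp (fun x => ¬ p x) = -1 := by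
      ext x y
      change M' x y = _
      rw [htri x x.2, Matrix.neg_apply, Matrix.one_apply]
      simp only [Subtype.coe_inj]
      split_ifs <;> simp
    rw [this, Matrix.det_neg, Matrix.det_one, mul_one, hcard]
  rw [hdet, hlast, hrest, mul_comm] at h2
  exact mul_right_cancel₀ (pow_ne_zero _ (by norm_num)) h2

/-! ### Disjoint unions of paths -/

section Paths

variable {V : Type*}

theorem component_eq_iff {E : Digraph V} {v w : V} :
    component E v = component E w ↔ Relation.EqvGen E.Adj v w :=
  ⟨fun h => Quotient.exact h, fun h => Quotient.sound h⟩

theorem eq_or_lt_of_reflTransGen {r : V → V → Prop} {κ : V → ℕ}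
    (hκ : ∀ v w, r v w → κ v < κ w) {v w : V} (h : Relation.ReflTransGen r v w) :
    v = w ∨ κ v < κ w := by
  induction h with
  | refl => exact Or.inl rfl
  | tail _ hbc ih =>
    rcases ih with rfl | ih
    · exact Or.inr (hκ _ _ hbc)
    · exact Or.inr (ih.trans (hκ _ _ hbc))

/-- Two vertices that are connected by a relation that is functional in both directions are
connected by a directed walk. -/
theorem reflTransGen_total_of_eqvGen {r : V → V → Prop} (hr : Relator.RightUnique r)
    (hl : Relator.LeftUnique r) {v w : V} (h : Relation.EqvGen r v w) :
    Relation.ReflTransGen r v w ∨ Relation.ReflTransGen r w v := by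
  induction h with
  | rel x y h => exact Or.inl (.single h)
  | refl x => exact Or.inl .refl
  | symm x y _ ih => exact ih.symm
  | trans x y z _ _ ih1 ih2 =>
    rcases ih1 with h1 | h1 <;> rcases ih2 with h2 | h2
    · exact Or.inl (h1.trans h2)
    -- Both walks end at `y`; they are compared in the reversed relation, which is functional
    -- because `r` is left unique.
    · have hU : Relator.RightUnique (Function.swap r) := fun a b c hab hac => hl hab hac
      have := Relation.ReflTransGen.total_of_right_unique hU
        (Relation.reflTransGen_swap.2 h1) (Relation.reflTransGen_swap.2 h2)
      exact this.symm.imp Relation.reflTransGen_swap.1 Relation.reflTransGen_swap.1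
    · exact Relation.ReflTransGen.total_of_right_unique hr h1 h2
    · exact Or.inr (h2.trans h1)

/-- A finite digraph whose arrows form a partial injection along which some function increases
is a disjoint union of paths. -/
theorem isPathComponent_of_increasing [Finite V] (E : Digraph V) (κ : V → ℕ)
    (hr : Relator.RightUnique E.Adj) (hl : Relator.LeftUnique E.Adj)
    (hκ : ∀ v w, E.Adj v w → κ v < κ w) (C : Component E) : IsPathComponent E C := by
  classical
  have := Fintype.ofFinite V
  let S := {v : V // component E v = C}
  have htot : ∀ x y : S, Relation.ReflTransGen E.Adj x.1 y.1 ∨ Relation.ReflTransGen E.Adj y.1 x.1 :=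
    fun x y => reflTransGen_total_of_eqvGen hr hl (component_eq_iff.1 (x.2.trans y.2.symm))
  -- Two vertices of a component are joined by a directed walk, along which `κ` grows. So `κ` orders
  -- the component, and the arrows must be shown to join exactly the consecutive vertices.
  have hinj : Function.Injective fun x : S => κ x.1 := fun x y hxy => by
    have hxy : κ x.1 = κ y.1 := hxy
    rcases htot x y with h | h <;> rcases eq_or_lt_of_reflTransGen hκ h with h | h
    · exact Subtype.ext h
    · omega
    · exact Subtype.ext h.symm
    · omega
  let _ : LinearOrder S := LinearOrder.lift' (fun x : S => κ x.1) hinj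
  let f : Fin (Fintype.card S) ≃o S := Fintype.orderIsoFinOfCardEq S rfl
  have hf : ∀ i j, i < j ↔ κ (f i).1 < κ (f j).1 := fun i j => (f.lt_iff_lt (x := i) (y := j)).symm
  refine ⟨_, f.toEquiv, fun i j => ⟨fun h => ?_, fun h => ?_⟩⟩
  · have hij : i < j := (hf i j).2 (hκ _ _ h)
    by_contra hne
    -- If an arrow skipped the vertex `k`, the walk from `f i` to `f k` would have to begin with
    -- that arrow and so rise past `k` already at `f j`.
    have hlt : (i : ℕ) + 1 < j := lt_of_le_of_ne hij hne
    let k : Fin (Fintype.card S) := ⟨i + 1, hlt.trans j.2⟩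
    have hik : i < k := Nat.lt_succ_self i
    have hkj : k < j := hlt
    rw [hf] at hik hkj
    have h1 : Relation.ReflTransGen E.Adj (f i).1 (f k).1 := by
      refine (htot (f i) (f k)).resolve_right fun h' => ?_
      rcases eq_or_lt_of_reflTransGen hκ h' with h' | h'
      · rw [h'] at hik; exact lt_irrefl _ hik
      · omega
    rcases h1.cases_head with h1 | ⟨x, hx, hxk⟩
    · rw [h1] at hik; exact lt_irrefl _ hik
    · have hxj : x = (f j).1 := hr hx h
      subst hxj
      rcases eq_or_lt_of_reflTransGen hκ hxk with h' | h'
      · rw [h'] at hkj; exact lt_irrefl _ hkj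
      · omega
  · have hij : i < j := by rw [Fin.lt_def]; omega
    have hij' := (hf i j).1 hij
    have h1 : Relation.ReflTransGen E.Adj (f i).1 (f j).1 := by
      refine (htot (f i) (f j)).resolve_right fun h' => ?_
      rcases eq_or_lt_of_reflTransGen hκ h' with h' | h'
      · rw [h'] at hij'; exact lt_irrefl _ hij'
      · omega
    rcases h1.cases_head with h1 | ⟨x, hx, hxj⟩
    · rw [h1] at hij'; exact absurd hij' (lt_irrefl _)
    -- The first step of the walk lands strictly after `i` and not after `j`; since `j` is the
    -- successor of `i`, it lands on `f j`.
    · have hxC : component E x = C :=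
        (component_eq_iff.2 (.symm _ _ (.rel _ _ hx))).trans (f i).2
      obtain ⟨k, hk⟩ := f.surjective ⟨x, hxC⟩
      have hk' : (f k).1 = x := congrArg Subtype.val hk
      have hik : i < k := (hf i k).2 (by rw [hk']; exact hκ _ _ hx)
      have hkj : k ≤ j := by
        by_contra hjk
        have := (hf j k).1 (not_le.1 hjk)
        rw [hk'] at this
        rcases eq_or_lt_of_reflTransGen hκ hxj with h' | h'
        · rw [h'] at this; exact lt_irrefl _ this
        · omega
      have : k = j := by
        rw [Fin.lt_def] at hik
        rw [Fin.le_def] at hkj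
        exact Fin.ext (by omega)
      subst this
      change E.Adj (f i).1 (f k).1
      rw [hk']
      exact hx

/-- Coordinates on the vertices of a disjoint union of paths: the component and the position in it. -/
theorem exists_path_coordinates (E : Digraph V) (hE : ∀ C, IsPathComponent E C) :
    ∃ (l : Component E → ℕ) (e : (Σ C, Fin (l C + 1)) ≃ V),
      (∀ x, component E (e x) = x.1) ∧
      (∀ C, Nat.card {v : V // component E v = C} = l C + 1) ∧
      ∀ C i w, E.Adj (e ⟨C, i⟩) w ↔ ∃ j : Fin (l C + 1), (i : ℕ) + 1 = j ∧ w = e ⟨C, j⟩ := by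
  have h : ∀ C, ∃ (l : ℕ) (f : Fin (l + 1) ≃ {v : V // component E v = C}),
      ∀ i j, E.Adj (f i) (f j) ↔ (i : ℕ) + 1 = j := by
    intro C
    obtain ⟨m, f, hf⟩ := hE C
    -- Components are nonempty, which permits the form `l + 1`; here `l` is the number of arrows of
    -- the path.
    cases m with
    | zero =>
      obtain ⟨v, hv⟩ := Quotient.mk_surjective C
      exact (f.symm ⟨v, hv⟩).elim0
    | succ m => exact ⟨m, f, hf⟩
  choose l f hf using h
  let e : (Σ C, Fin (l C + 1)) ≃ V :=
    (Equiv.sigmaCongrRight f).trans (Equiv.sigmaFiberEquiv (component E))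
  have he : ∀ C i, e ⟨C, i⟩ = (f C i).1 := fun _ _ => rfl
  refine ⟨l, e, fun x => (f x.1 x.2).2,
    fun C => by rw [← Nat.card_congr (f C), Nat.card_fin], fun C i w => ⟨fun h => ?_, ?_⟩⟩
  · rw [he] at h
    have hw : component E w = C := (component_eq_iff.2 (.symm _ _ (.rel _ _ h))).trans (f C i).2
    obtain ⟨j, hj⟩ := (f C).surjective ⟨w, hw⟩
    have hj' : (f C j).1 = w := congrArg Subtype.val hj
    subst hj'
    exact ⟨j, (hf C i j).1 h, rfl⟩
  · rintro ⟨j, hij, rfl⟩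
    exact (hf C i j).2 hij

theorem rightUnique_of_isPathComponent (E : Digraph V) (hE : ∀ C, IsPathComponent E C) :
    Relator.RightUnique E.Adj := by
  obtain ⟨l, e, -, -, hadj⟩ := exists_path_coordinates E hE
  intro v w w' h h'
  obtain ⟨⟨C, i⟩, rfl⟩ := e.surjective v
  obtain ⟨j, hj, rfl⟩ := (hadj _ _ _).1 h
  obtain ⟨j', hj', rfl⟩ := (hadj _ _ _).1 h'
  rw [Fin.ext (hj.symm.trans hj') (a := j) (b := j')]

/-! ### Path covers and the expansion of a determinant -/

variable [Fintype V] [DecidableEq V]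

open Classical in
/-- The matrix of a digraph `D` in which the row of each vertex with a successor in `E` is replaced
by minus the indicator of its successors in `E`. -/
noncomputable def coverMatrix (D E : Digraph V) : Matrix V V ℤ :=
  Matrix.of fun v w =>
    if ∃ u, E.Adj v u then (if E.Adj v w then -1 else 0) else adjacencyMatrix D v w

/-- The determinant of a contraction as a determinant indexed by the vertices. -/
theorem digraphDet_contraction (D E : Digraph V) (hE : ∀ C, IsPathComponent E C) :
    digraphDet (contraction D E) = (coverMatrix D E).det := by
  classical
  obtain ⟨l, e, hcomp, -, hadj⟩ := exists_path_coordinates E hE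
  have hend : ∀ C i, (∃ u, E.Adj (e ⟨C, i⟩) u) ↔ i ≠ Fin.last _ := by
    intro C i
    constructor
    · rintro ⟨u, hu⟩ rfl
      obtain ⟨j, hj, -⟩ := (hadj _ _ _).1 hu
      have := j.2
      rw [Fin.val_last] at hj
      omega
    · intro hi
      have hi' := Fin.val_lt_last hi
      exact ⟨_, (hadj _ _ _).2 ⟨⟨i + 1, by omega⟩, rfl, rfl⟩⟩
  have hbeg : ∀ C i, (∃ u, E.Adj u (e ⟨C, i⟩)) ↔ i ≠ 0 := by
    intro C i
    constructor
    · rintro ⟨u, hu⟩ rfl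
      obtain ⟨⟨C', k⟩, rfl⟩ := e.surjective u
      obtain ⟨j, hj, h⟩ := (hadj _ _ _).1 hu
      have h := e.injective h
      obtain rfl : C = C' := congrArg Sigma.fst h
      have : (0 : Fin (l C + 1)) = j := by simpa using h
      rw [← this] at hj
      simp at hj
    · intro hi
      have hi' : (i : ℕ) ≠ 0 := fun h => hi (Fin.ext h)
      refine ⟨e ⟨C, ⟨i - 1, by omega⟩⟩, (hadj _ _ _).2 ⟨i, ?_, rfl⟩⟩
      change (i : ℕ) - 1 + 1 = i
      omega
  -- In path coordinates, a row of `coverMatrix` that is not at the end of a path is minus the unit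
  -- vector of the next vertex, as `det_eq_det_ends` requires.
  rw [← Matrix.det_submatrix_equiv_self e, det_eq_det_ends l]
  · unfold digraphDet
    congr! 1
    ext C C'
    simp only [adjacencyMatrix, coverMatrix, Matrix.of_apply, Matrix.submatrix_apply]
    rw [if_neg (show ¬ ∃ u, E.Adj (e ⟨C, Fin.last _⟩) u from fun h => (hend _ _).1 h rfl)]
    refine if_congr ?_ rfl rfl
    constructor
    · rintro ⟨v, w, hv, hv', hw, hw', h⟩
      obtain ⟨⟨C1, i⟩, rfl⟩ := e.surjective v
      obtain ⟨⟨C2, j⟩, rfl⟩ := e.surjective w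
      obtain rfl : C1 = C := (hcomp _).symm.trans hv
      obtain rfl : C2 = C' := (hcomp _).symm.trans hw
      have hi : i = Fin.last _ := by
        by_contra hi
        obtain ⟨u, hu⟩ := (hend _ _).2 hi
        exact hv' u hu
      have hj : j = 0 := by
        by_contra hj
        obtain ⟨u, hu⟩ := (hbeg _ _).2 hj
        exact hw' u hu
      rwa [hi, hj] at h
    · intro h
      refine ⟨_, _, hcomp ⟨C, Fin.last _⟩, fun u hu => ?_, hcomp ⟨C', 0⟩, fun u hu => ?_, h⟩
      · exact (hend _ _).1 ⟨u, hu⟩ rfl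
      · exact (hbeg _ _).1 ⟨u, hu⟩ rfl
  · intro C i hi x
    simp only [coverMatrix, Matrix.of_apply, Matrix.submatrix_apply]
    rw [if_pos ((hend _ _).2 hi)]
    refine if_congr ?_ rfl rfl
    rw [hadj]
    have hrot : ((finRotate _ i : Fin (l C + 1)) : ℕ) = i + 1 :=
      coe_finRotate_of_ne_last hi
    constructor
    · rintro ⟨j, hj, h⟩
      rw [e.injective h, Fin.ext (hj.symm.trans hrot.symm)]
    · rintro rfl
      exact ⟨_, hrot.symm, rfl⟩

open Classical in
/-- Expansion of the determinant of the subdigraph of non-increasing arrows of `D` over the path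
covers of `D` with increasing arrows. -/
theorem det_nonincreasing_eq_sum (D : Digraph V) (κ : V → ℕ) :
    (Matrix.of fun v w => if κ v < κ w then 0 else adjacencyMatrix D v w).det =
      ∑ E : Digraph V with IsPathCover D E ∧ ∀ v w, E.Adj v w → κ v < κ w,
        digraphDet (contraction D E) := by
  have hsum : ∀ E ∈ (Finset.univ.filter fun E : Digraph V =>
      IsPathCover D E ∧ ∀ v w, E.Adj v w → κ v < κ w), digraphDet (contraction D E) =
      ∑ g : Equiv.Perm V, Equiv.Perm.sign g • ∏ v, (coverMatrix D E).transpose (g v) v := by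
    intro E hE
    rw [digraphDet_contraction D E (Finset.mem_filter.1 hE).2.1.2, ← Matrix.det_transpose,
      Matrix.det_apply]
  rw [Finset.sum_congr rfl hsum, Finset.sum_comm, ← Matrix.det_transpose, Matrix.det_apply]
  refine Finset.sum_congr rfl fun g _ => ?_
  rw [← Finset.smul_sum]
  congr 1
  simp only [Matrix.transpose_apply]
  let A := adjacencyMatrix D
  -- At an increasing position the deleted entry is 0 = −A + A, so every entry is `K + A`. The set
  -- `T` below records the factors from which `K` is taken.
  let K : V → ℤ := fun v => if κ v < κ (g v) then -A v (g v) else 0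
  have hprod : ∏ v, (Matrix.of fun v w => if κ v < κ w then 0 else A v w) v (g v) =
      ∑ T : Finset V, ∏ v, if v ∈ T then K v else A v (g v) := by
    have h1 : ∀ v, (Matrix.of fun v w => if κ v < κ w then 0 else A v w) v (g v) =
        K v + A v (g v) := by
      intro v
      simp only [Matrix.of_apply, K]
      split_ifs <;> simp
    rw [Finset.prod_congr rfl fun v _ => h1 v, Finset.prod_add, Finset.powerset_univ]
    refine Finset.sum_congr rfl fun T _ => ?_
    rw [Finset.prod_ite (p := fun v => v ∈ T)]
    congr 1
    · exact Finset.prod_congr (by ext; simp) fun _ _ => rfl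
    · exact Finset.prod_congr (by ext; simp) fun _ _ => rfl
  have hA : ∀ v w, A v w ≠ 0 → D.Adj v w ∧ A v w = 1 := by
    intro v w h
    simp only [A, adjacencyMatrix, Matrix.of_apply] at h ⊢
    split_ifs at h ⊢ with h'
    · exact ⟨h', rfl⟩
    · exact absurd rfl h
  have hT : ∀ T : Finset V, (∏ v, if v ∈ T then K v else A v (g v)) ≠ 0 →
      ∀ v ∈ T, κ v < κ (g v) ∧ D.Adj v (g v) ∧ K v = -1 := by
    intro T h v hv
    have := Finset.prod_ne_zero_iff.1 h v (Finset.mem_univ v)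
    rw [if_pos hv] at this
    simp only [K] at this ⊢
    split_ifs at this ⊢ with h'
    · obtain ⟨h1, h2⟩ := hA v (g v) (neg_ne_zero.1 this)
      exact ⟨h', h1, by rw [h2]⟩
    · exact absurd rfl this
  rw [hprod]
  -- For fixed `g`, the set `T` corresponds to the digraph of the arrows `v → g v` with `v ∈ T`. A
  -- nonzero term of `T` makes these increasing arrows of `D`; conversely, a nonzero term of `E`
  -- forces `g` to follow `E`, so `T` is recovered as the set of vertices with a successor.
  refine Finset.sum_bij_ne_zero (fun T _ _ => (⟨fun v w => v ∈ T ∧ w = g v⟩ : Digraph V))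
    ?_ ?_ ?_ ?_
  · intro T _ h
    rw [Finset.mem_filter]
    refine ⟨Finset.mem_univ _, ⟨?_, fun C => isPathComponent_of_increasing _ κ ?_ ?_ ?_ C⟩, ?_⟩
    · rintro v w ⟨hv, rfl⟩
      exact (hT T h v hv).2.1
    · rintro v w w' ⟨_, rfl⟩ ⟨_, rfl⟩
      rfl
    · rintro v w w' ⟨_, h1⟩ ⟨_, h2⟩
      exact g.injective (h1.symm.trans h2)
    · rintro v w ⟨hv, rfl⟩
      exact (hT T h v hv).1
    · rintro v w ⟨hv, rfl⟩
      exact (hT T h v hv).1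
  · intro T _ _ T' _ _ h
    ext v
    have := congrFun (congrFun (congrArg Digraph.Adj h) v) (g v)
    simpa using this
  · intro E hE h
    rw [Finset.mem_filter] at hE
    have hv : ∀ v, (∃ u, E.Adj v u) → E.Adj v (g v) := by
      intro v hv
      have := Finset.prod_ne_zero_iff.1 h v (Finset.mem_univ v)
      simp only [coverMatrix, Matrix.of_apply] at this
      rw [if_pos hv] at this
      by_contra h'
      exact this (if_neg h')
    have hval : (∏ v, if v ∈ (Finset.univ.filter fun v => ∃ u, E.Adj v u) then K v
        else A v (g v)) = ∏ v, coverMatrix D E v (g v) := by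
      refine Finset.prod_congr rfl fun v _ => ?_
      simp only [coverMatrix, Matrix.of_apply, Finset.mem_filter, Finset.mem_univ, true_and]
      split_ifs with h1 h2
      · simp only [K, A, adjacencyMatrix, Matrix.of_apply]
        rw [if_pos (hE.2.2 _ _ h2), if_pos (hE.2.1.1 h2)]
      · exact absurd (hv v h1) h2
      · rfl
    refine ⟨Finset.univ.filter fun v => ∃ u, E.Adj v u, Finset.mem_univ _, hval ▸ h, ?_⟩
    ext v w
    simp only [Finset.mem_filter, Finset.mem_univ, true_and]
    constructor
    · rintro ⟨h1, rfl⟩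
      exact hv v h1
    · intro h1
      exact ⟨⟨w, h1⟩, rightUnique_of_isPathComponent E hE.2.1.2 h1 (hv v ⟨w, h1⟩)⟩
  · intro T _ h
    refine Finset.prod_congr rfl fun v _ => ?_
    simp only [coverMatrix, Matrix.of_apply]
    by_cases hv : v ∈ T
    · simp [hv, (hT T h v hv).2.2]
    · simp [hv, A]

end Paths

/-! ### Colourings with given content and elementary symmetric functions -/

section Coefficients

/-- The exponent vector of the monomial of a colouring. -/
noncomputable def content {V : Type*} [Fintype V] (κ : V → ℕ) : ℕ →₀ ℕ :=
  ∑ v, Finsupp.single (κ v) 1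

theorem content_apply {V : Type*} [Fintype V] (κ : V → ℕ) (i : ℕ) :
    content κ i = (Finset.univ.filter fun v => κ v = i).card := by
  rw [content, Finsupp.finsetSum_apply, Finset.card_filter]
  simp only [Finsupp.single_apply]

theorem support_content {V : Type*} [Fintype V] (κ : V → ℕ) :
    ((content κ).support : Set ℕ) = Set.range κ := by
  ext i
  simp [content_apply, Finset.filter_eq_empty_iff]

theorem degree_content {V : Type*} [Fintype V] (κ : V → ℕ) :
    (content κ).degree = Fintype.card V := by
  simp [content, map_sum]

theorem content_comp_equiv {V W : Type*} [Fintype V] [Fintype W] (e : V ≃ W) (κ : W → ℕ) :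
    content (fun v => κ (e v)) = content κ :=
  Equiv.sum_comp e fun w => Finsupp.single (κ w) 1

theorem content_le_one {V : Type*} [Fintype V] {κ : V → ℕ} (hκ : Function.Injective κ) (i : ℕ) :
    content κ i ≤ 1 := by
  rw [content_apply, Finset.card_le_one]
  intro a ha b hb
  exact hκ ((Finset.mem_filter.1 ha).2.trans (Finset.mem_filter.1 hb).2.symm)

/-- The monomials of `elem k` correspond to strictly increasing sequences. -/
theorem exists_strictMono_content {k : ℕ} {d : ℕ →₀ ℕ} (h1 : ∀ i, d i ≤ 1) (h2 : d.degree = k) :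
    ∃ κ : Fin k → ℕ, StrictMono κ ∧ content κ = d := by
  have hcard : d.support.card = k := by
    rw [← h2, Finsupp.degree_apply, Finset.card_eq_sum_ones]
    refine Finset.sum_congr rfl fun i hi => ?_
    have := h1 i
    have := Finsupp.mem_support_iff.1 hi
    omega
  have hmono := (d.support.orderEmbOfFin hcard).strictMono
  refine ⟨d.support.orderEmbOfFin hcard, hmono, ?_⟩
  have hs : (content (d.support.orderEmbOfFin hcard)).support = d.support := by
    rw [← Finset.coe_inj, support_content, Finset.range_orderEmbOfFin]
  ext i
  have h3 := content_le_one hmono.injective i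
  have h4 := h1 i
  have h5 := Finset.ext_iff.1 hs i
  rw [Finsupp.mem_support_iff, Finsupp.mem_support_iff] at h5
  omega

theorem content_injOn_strictMono {k : ℕ} {κ κ' : Fin k → ℕ} (hκ : StrictMono κ)
    (hκ' : StrictMono κ') (h : content κ = content κ') : κ = κ' := by
  rw [← hκ.range_inj hκ', ← support_content, ← support_content, h]

variable {V : Type*} [Fintype V]

open Classical in
/-- The colourings with a given content. -/
noncomputable def colorings (V : Type*) [Fintype V] (d : ℕ →₀ ℕ) : Finset (V → ℕ) :=
  {κ ∈ Fintype.piFinset fun _ => d.support | content κ = d}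

/-- The colours of a colouring of content `d` lie in the support of `d`, so the finite ambient set
in `colorings` excludes nothing. -/
theorem mem_colorings {d : ℕ →₀ ℕ} {κ : V → ℕ} : κ ∈ colorings V d ↔ content κ = d := by
  classical
  rw [colorings, Finset.mem_filter, and_iff_right_iff_imp]
  rintro rfl
  rw [Fintype.mem_piFinset]
  intro v
  rw [← Finset.mem_coe, support_content]
  exact ⟨v, rfl⟩

open Classical in
/-- The coefficients of the elementary symmetric function of the type of a path cover count the
colourings that increase along the paths. -/
theorem coeff_elemPart_digraphType (E : Digraph V) (hE : ∀ C, IsPathComponent E C) (d : ℕ →₀ ℕ) :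
    MvPowerSeries.coeff d (elemPart (digraphType E)) =
      ((colorings V d).filter fun κ => ∀ v w, E.Adj v w → κ v < κ w).card := by
  obtain ⟨l, e, -, hcard, hadj⟩ := exists_path_coordinates E hE
  have hprod : elemPart (digraphType E) = ∏ C : Component E, elem (l C + 1) := by
    rw [elemPart, digraphType, Multiset.map_map]
    refine Finset.prod_congr rfl fun C _ => ?_
    rw [Function.comp_apply, ← hcard, Nat.card_eq_fintype_card]
  have hmono : ∀ κ : V → ℕ, (∀ v w, E.Adj v w → κ v < κ w) ↔
      ∀ C, StrictMono fun i => κ (e ⟨C, i⟩) := by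
    intro κ
    constructor
    · intro h C
      rw [Fin.strictMono_iff_lt_succ]
      exact fun i => h _ _ ((hadj _ _ _).2 ⟨i.succ, by simp, rfl⟩)
    · intro h v w hvw
      obtain ⟨⟨C, i⟩, rfl⟩ := e.surjective v
      obtain ⟨j, hj, rfl⟩ := (hadj _ _ _).1 hvw
      exact h C (by rw [Fin.lt_def]; omega)
  have hsum : ∀ κ : V → ℕ, ∑ C, content (fun i => κ (e ⟨C, i⟩)) = content κ := by
    intro κ
    rw [← content_comp_equiv e κ]
    simp only [content]
    rw [Fintype.sum_sigma]
  rw [hprod, MvPowerSeries.coeff_prod]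
  have hcoeff : ∀ (k : ℕ) (a : ℕ →₀ ℕ), MvPowerSeries.coeff a (elem k) =
      if (∀ i, a i ≤ 1) ∧ a.degree = k then 1 else 0 := fun k a => rfl
  simp only [hcoeff, Finset.prod_ite_zero, Finset.prod_const_one]
  rw [← Finset.sum_filter, Finset.sum_const, nsmul_eq_mul, mul_one, Nat.cast_inj]
  symm
  -- The product coefficient counts the ways to split `d` into one squarefree exponent of the right
  -- degree per path. Such an exponent is the content of exactly one increasing colouring of its
  -- path.
  refine Finset.card_bij
    (fun κ _ => Finsupp.equivFunOnFinite.symm fun C => content fun i => κ (e ⟨C, i⟩)) ?_ ?_ ?_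
  · intro κ hκ
    rw [Finset.mem_filter, mem_colorings, hmono] at hκ
    rw [Finset.mem_filter, Finset.mem_finsuppAntidiag]
    refine ⟨⟨?_, Finset.subset_univ _⟩, fun C _ => ⟨?_, ?_⟩⟩
    · rw [← hκ.1, ← hsum κ]
      rfl
    · exact content_le_one (hκ.2 C).injective
    · exact (degree_content _).trans (Fintype.card_fin _)
  · intro κ hκ κ' hκ' h
    rw [Finset.mem_filter, mem_colorings, hmono] at hκ hκ'
    funext v
    obtain ⟨⟨C, i⟩, rfl⟩ := e.surjective v
    have h := congrFun (Finsupp.equivFunOnFinite.symm.injective h) C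
    exact congrFun (content_injOn_strictMono (hκ.2 C) (hκ'.2 C) h) i
  · intro a ha
    rw [Finset.mem_filter, Finset.mem_finsuppAntidiag] at ha
    choose κ hκ hκa using fun C =>
      exists_strictMono_content (ha.2 C (Finset.mem_univ C)).1 (ha.2 C (Finset.mem_univ C)).2
    have hκ' : ∀ C, (fun i => (fun v => κ (e.symm v).1 (e.symm v).2) (e ⟨C, i⟩)) = κ C := by
      intro C
      funext i
      exact congrArg (fun x : Σ C, Fin (l C + 1) => κ x.1 x.2) (e.symm_apply_apply ⟨C, i⟩)
    have heq : ∀ C, content (fun i => (fun v => κ (e.symm v).1 (e.symm v).2) (e ⟨C, i⟩)) = a C :=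
      fun C => by rw [hκ' C, hκa]
    refine ⟨fun v => κ (e.symm v).1 (e.symm v).2, ?_, ?_⟩
    · rw [Finset.mem_filter, mem_colorings, hmono, ← hsum]
      refine ⟨?_, fun C => by rw [hκ' C]; exact hκ C⟩
      rw [Finset.sum_congr rfl fun C _ => heq C]
      exact ha.1.1
    · ext1 C
      exact heq C

end Coefficients

/-! ### Proper colourings and the chromatic symmetric function -/

section Chromatic

variable {V : Type*} [Fintype V]

theorem part_surjective [DecidableEq V] (σ : Finpartition (Finset.univ : Finset V)) (b : σ.parts) :
    ∃ v, (⟨σ.part v, σ.part_mem.2 (Finset.mem_univ v)⟩ : σ.parts) = b := by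
  obtain ⟨v, hv⟩ := σ.nonempty_of_mem_parts b.2
  exact ⟨v, Subtype.ext (σ.part_eq_of_mem b.2 hv)⟩

theorem count_map_val {ι : Type*} (t : Finset ι) (f : ι → ℕ) (i : ℕ) :
    (t.val.map f).count i = Fintype.card {x : t // f x = i} := by
  classical
  rw [Multiset.count_map, Fintype.card_subtype, ← Finset.card_map (Function.Embedding.subtype _),
    ← Finset.filter_val]
  change (Finset.filter _ t).card = _
  congr 1
  ext x
  simp [eq_comm, and_comm]

theorem card_filter_part [DecidableEq V] (σ : Finpartition (Finset.univ : Finset V)) (b : σ.parts) :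
    (Finset.univ.filter fun v => σ.part v = b).card = b.1.card := by
  congr 1
  ext v
  simp [σ.part_eq_iff_mem b.2]

open Classical in
/-- The coefficients of the augmented monomial symmetric function of the type of a set partition
count the colourings whose fibres are the blocks. -/
theorem coeff_augMonom_blockType (σ : Finpartition (Finset.univ : Finset V)) (d : ℕ →₀ ℕ) :
    MvPowerSeries.coeff d (augMonom (blockType σ)) =
      ((colorings V d).filter fun κ => ∀ v w, κ v = κ w ↔ σ.part v = σ.part w).card := by
  let q : V → σ.parts := fun v => ⟨σ.part v, σ.part_mem.2 (Finset.mem_univ v)⟩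
  have hq : Function.Surjective q := part_surjective σ
  have hqq : ∀ v w, q v = q w ↔ σ.part v = σ.part w := fun v w => Subtype.ext_iff
  let s : σ.parts → ℕ := fun b => b.1.card
  have hqs : ∀ b, (Finset.univ.filter fun v => q v = b).card = s b := fun b => by
    refine Eq.trans ?_ (card_filter_part σ b)
    simp only [Subtype.ext_iff, q]
  have hcoeff : MvPowerSeries.coeff d (augMonom (blockType σ)) =
      (if d.support.val.map d = σ.parts.val.map Finset.card then
        ∏ i ∈ (σ.parts.val.map Finset.card).toFinset,
          ((σ.parts.val.map Finset.card).count i).factorial else 0 : ℕ) := by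
    rw [augMonom, map_nsmul]
    change _ • (if d.support.val.map d = σ.parts.val.map Finset.card then (1 : ℤ) else 0) = _
    split_ifs
    · rw [nsmul_eq_mul, mul_one]
      rfl
    · simp
  rw [hcoeff, Nat.cast_inj]
  -- A colouring with fibres the blocks of `σ` amounts to a bijection from blocks to used colours
  -- that matches block sizes with exponents.
  have hfacts : ∀ κ ∈ ((colorings V d).filter fun κ => ∀ v w, κ v = κ w ↔ σ.part v = σ.part w),
      ∃ ψ : σ.parts ≃ d.support, (∀ v, (ψ (q v) : ℕ) = κ v) ∧ ∀ b, d (ψ b) = s b := by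
    intro κ hκ
    rw [Finset.mem_filter, mem_colorings] at hκ
    obtain ⟨rfl, hκ⟩ := hκ
    let g : σ.parts → ℕ := fun b => κ (hq b).choose
    have hg : ∀ v, g (q v) = κ v := fun v =>
      (hκ _ _).2 ((hqq _ _).1 (hq (q v)).choose_spec)
    have hmem : ∀ b, g b ∈ (content κ).support := fun b => by
      rw [← Finset.mem_coe, support_content]
      exact ⟨_, rfl⟩
    let ψ : σ.parts → (content κ).support := fun b => ⟨g b, hmem b⟩
    have hψ : Function.Bijective ψ := by
      constructor
      · intro b b' h
        obtain ⟨v, rfl⟩ := hq b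
        obtain ⟨w, rfl⟩ := hq b'
        have : g (q v) = g (q w) := congrArg Subtype.val h
        rw [hg, hg] at this
        exact (hqq _ _).2 ((hκ _ _).1 this)
      · rintro ⟨i, hi⟩
        rw [← Finset.mem_coe, support_content] at hi
        obtain ⟨v, rfl⟩ := hi
        exact ⟨q v, Subtype.ext (hg v)⟩
    refine ⟨Equiv.ofBijective ψ hψ, hg, fun b => ?_⟩
    obtain ⟨v, rfl⟩ := hq b
    change content κ (g (q v)) = _
    rw [hg, content_apply, ← hqs]
    simp only [hκ, hqq]
  split_ifs with h
  · have hfib : ∀ i, Nonempty ({b : σ.parts // s b = i} ≃ {j : d.support // d j = i}) := by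
      intro i
      rw [← Fintype.card_eq, ← count_map_val σ.parts Finset.card, ← count_map_val d.support d, h]
    let φ : σ.parts ≃ d.support := Equiv.ofFiberEquiv fun i => (hfib i).some
    have hφ : ∀ b, d (φ b) = s b := fun b =>
      Equiv.ofFiberEquiv_map (g := fun j : d.support => d j) _ b
    have hstab : ∏ i ∈ (σ.parts.val.map Finset.card).toFinset,
          ((σ.parts.val.map Finset.card).count i).factorial =
        Fintype.card {g : Equiv.Perm σ.parts // s ∘ g = s} := by
      rw [DomMulAct.stabilizer_card']
      refine Finset.prod_congr ?_ fun i _ => by rw [count_map_val]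
      ext i
      simp [s]
    -- Relative to the fixed matching `φ`, all others are `φ ∘ g` with `g` a size-preserving
    -- permutation of the blocks. The number of such `g` is the product of factorials in `augMonom`.
    rw [hstab, Fintype.card_subtype]
    refine Finset.card_bij (fun g _ v => (φ (g (q v)) : ℕ)) ?_ ?_ ?_
    · intro g hg
      have hg := (Finset.mem_filter.1 hg).2
      rw [Finset.mem_filter, mem_colorings]
      constructor
      · ext i
        rw [content_apply]
        by_cases hi : i ∈ d.support
        · obtain ⟨b, hb⟩ := (g.trans φ).surjective ⟨i, hi⟩
          have hb' : (φ (g b) : ℕ) = i := congrArg Subtype.val hb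
          rw [← hb', hφ, show s (g b) = s b from congrFun hg b, ← hqs]
          simp only [Subtype.coe_inj, φ.injective.eq_iff, g.injective.eq_iff]
        · rw [Finsupp.notMem_support_iff.1 hi, Finset.card_eq_zero, Finset.filter_eq_empty_iff]
          rintro v - rfl
          exact hi (φ (g (q v))).2
      · intro v w
        rw [Subtype.coe_inj, φ.injective.eq_iff, g.injective.eq_iff, hqq]
    · intro g _ g' _ hgg
      ext1 b
      obtain ⟨v, rfl⟩ := hq b
      exact φ.injective (Subtype.ext (congrFun hgg v))
    · intro κ hκ
      obtain ⟨ψ, hψ, hψd⟩ := hfacts κ hκ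
      refine ⟨ψ.trans φ.symm, ?_, ?_⟩
      · rw [Finset.mem_filter]
        refine ⟨Finset.mem_univ _, ?_⟩
        funext b
        rw [← hψd, Function.comp_apply, ← hφ]
        simp
      · funext v
        rw [← hψ]
        simp
  · symm
    rw [Finset.card_eq_zero, Finset.eq_empty_iff_forall_notMem]
    intro κ hκ
    obtain ⟨ψ, -, hψd⟩ := hfacts κ hκ
    refine h ?_
    ext i
    rw [count_map_val, count_map_val]
    refine (Fintype.card_congr (ψ.subtypeEquiv fun b => ?_)).symm
    rw [hψd]

open Classical in
/-- The coefficients of the chromatic symmetric function count the proper colourings. -/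
theorem coeff_chromaticSymm (G : SimpleGraph V) (d : ℕ →₀ ℕ) :
    MvPowerSeries.coeff d (chromaticSymm G) =
      ((colorings V d).filter fun κ => ∀ v w, κ v = κ w → ¬ G.Adj v w).card := by
  -- Proper colourings are sorted by their partition into colour classes, whose blocks are then
  -- independent.
  let f : (V → ℕ) → Finpartition (Finset.univ : Finset V) :=
    fun κ => Finpartition.ofSetoid (Setoid.ker κ)
  have hf : ∀ (σ : Finpartition (Finset.univ : Finset V)) κ,
      (∀ v w, κ v = κ w ↔ σ.part v = σ.part w) ↔ f κ = σ := by
    intro σ κ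
    have hpart : ∀ v w, κ v = κ w ↔ (f κ).part v = (f κ).part w := by
      intro v w
      rw [← (f κ).mem_part_iff_part_eq_part (Finset.mem_univ _) (Finset.mem_univ _),
        Finpartition.mem_part_ofSetoid_iff_rel]
      exact eq_comm
    constructor
    · intro h
      have heq : ∀ v, (f κ).part v = σ.part v := by
        intro v
        ext w
        rw [Finpartition.mem_part_iff_part_eq_part _ (Finset.mem_univ _) (Finset.mem_univ _),
          Finpartition.mem_part_iff_part_eq_part _ (Finset.mem_univ _) (Finset.mem_univ _),
          ← hpart, ← h]
      ext b
      constructor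
      · intro hb
        obtain ⟨v, hv⟩ := part_surjective (f κ) ⟨b, hb⟩
        have hv : (f κ).part v = b := congrArg Subtype.val hv
        rw [← hv, heq]
        exact σ.part_mem.2 (Finset.mem_univ v)
      · intro hb
        obtain ⟨v, hv⟩ := part_surjective σ ⟨b, hb⟩
        have hv : σ.part v = b := congrArg Subtype.val hv
        rw [← hv, ← heq]
        exact (f κ).part_mem.2 (Finset.mem_univ v)
    · rintro rfl
      exact hpart
  have hG : ∀ κ, (∀ v w, κ v = κ w → ¬ G.Adj v w) ↔
      ∀ b ∈ (f κ).parts, G.IsIndepSet (SetLike.coe b) := by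
    intro κ
    have hpart := (hf (f κ) κ).2 rfl
    constructor
    · intro h b hb v hv w hw _
      refine h v w ((hpart v w).2 ?_)
      rw [(f κ).part_eq_of_mem hb hv, (f κ).part_eq_of_mem hb hw]
    · intro h v w hvw hadj
      refine h _ ((f κ).part_mem.2 (Finset.mem_univ v)) ((f κ).mem_part (Finset.mem_univ v)) ?_
        hadj.ne hadj
      have := (f κ).mem_part (Finset.mem_univ w)
      rwa [← (hpart v w).1 hvw] at this
  rw [chromaticSymm, map_sum]
  simp only [coeff_augMonom_blockType]
  rw [← Nat.cast_sum, Nat.cast_inj]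
  rw [Finset.card_eq_sum_card_fiberwise (f := f)
    (t := Finset.univ.filter fun σ => ∀ b ∈ σ.parts, G.IsIndepSet (SetLike.coe b))]
  · refine Finset.sum_congr rfl fun σ hσ => ?_
    rw [Finset.filter_filter]
    congr 1
    refine Finset.filter_congr fun κ _ => ?_
    rw [hf]
    constructor
    · rintro rfl
      exact ⟨(hG κ).2 (Finset.mem_filter.1 hσ).2, rfl⟩
    · exact fun h => h.2
  · intro κ hκ
    have hκ := (Finset.mem_filter.1 (Finset.mem_coe.1 hκ)).2
    exact Finset.mem_coe.2 (Finset.mem_filter.2 ⟨Finset.mem_univ _, (hG κ).1 hκ⟩)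

end Chromatic

/-! ### Linear independence of the elementary products -/

section Independence

/-- Setting all variables but finitely many to zero turns elementary symmetric functions into
elementary symmetric polynomials. -/
theorem killCompl_elem (N k : ℕ) :
    MvPowerSeries.killCompl (R := ℤ) (Fin.valEmbedding (n := N)) (elem k) =
      (MvPolynomial.esymm (Fin N) ℤ k : MvPowerSeries (Fin N) ℤ) := by
  classical
  ext x
  rw [MvPowerSeries.coeff_killCompl, MvPolynomial.coeff_coe, MvPolynomial.esymm_eq_sum_monomial,
    MvPolynomial.coeff_sum]
  simp only [MvPolynomial.coeff_monomial]
  change (if (∀ i, Finsupp.embDomain Fin.valEmbedding x i ≤ 1) ∧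
    (Finsupp.embDomain Fin.valEmbedding x).degree = k then (1 : ℤ) else 0) = _
  have hdeg : (Finsupp.embDomain (Fin.valEmbedding (n := N)) x).degree = x.degree := by
    rw [Finsupp.degree_apply, Finsupp.degree_apply, Finsupp.support_embDomain, Finset.sum_map]
    simp only [Finsupp.embDomain_apply_self]
  have hone : (∀ i, Finsupp.embDomain (Fin.valEmbedding (n := N)) x i ≤ 1) ↔ ∀ i, x i ≤ 1 := by
    constructor
    · intro h i
      rw [← Finsupp.embDomain_apply_self (Fin.valEmbedding (n := N)) x i]
      exact h _
    · intro h i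
      by_cases hi : i ∈ Set.range (Fin.valEmbedding (n := N))
      · obtain ⟨j, rfl⟩ := hi
        rw [Finsupp.embDomain_apply_self]
        exact h j
      · rw [Finsupp.embDomain_of_notMem_range _ _ _ hi]
        exact zero_le_one
  rw [hdeg, hone]
  have happ : ∀ (t : Finset (Fin N)) i,
      (∑ j ∈ t, Finsupp.single j 1 : Fin N →₀ ℕ) i = if i ∈ t then 1 else 0 := by
    intro t i
    rw [Finsupp.finsetSum_apply]
    simp [Finsupp.single_apply]
  -- At most one squarefree monomial has exponent `x`, so the sum over subsets collapses to the
  -- support of `x`.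
  have hsupp : ∀ t : Finset (Fin N), (∑ j ∈ t, Finsupp.single j 1 : Fin N →₀ ℕ) = x →
      t = x.support := by
    rintro t rfl
    ext i
    rw [Finsupp.mem_support_iff, happ]
    simp
  split_ifs with h
  · have hx : (∑ j ∈ x.support, Finsupp.single j 1 : Fin N →₀ ℕ) = x := by
      ext i
      rw [happ]
      have := h.1 i
      split_ifs with hi
      · have := Finsupp.mem_support_iff.1 hi
        omega
      · exact (Finsupp.notMem_support_iff.1 hi).symm
    rw [Finset.sum_eq_single x.support, if_pos hx]
    · intro t _ ht
      exact if_neg fun h' => ht (hsupp t h')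
    · intro h'
      refine absurd ?_ h'
      rw [Finset.mem_powersetCard_univ, ← h.2]
      conv_rhs => rw [← hx]
      simp [map_sum]
  · symm
    refine Finset.sum_eq_zero fun t ht => if_neg ?_
    rintro rfl
    refine h ⟨fun i => ?_, ?_⟩
    · rw [happ]
      split_ifs <;> simp
    · rw [Finset.mem_powersetCard_univ] at ht
      simp [map_sum, ht]

/-- The multiplicities of the parts `1, …, N` of a partition. -/
noncomputable def multiplicities (N : ℕ) {n : ℕ} (μ : n.Partition) : Fin N →₀ ℕ :=
  Finsupp.equivFunOnFinite.symm fun i => μ.parts.count (i + 1 : ℕ)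

/-- All parts lie between 1 and `N`, so these multiplicities determine the multiset of parts, and
its sum gives the size. -/
theorem multiplicities_injective {N n n' : ℕ} {μ : n.Partition} {μ' : n'.Partition}
    (hn : n ≤ N) (hn' : n' ≤ N) (h : multiplicities N μ = multiplicities N μ') :
    (⟨n, μ⟩ : Σ n : ℕ, n.Partition) = ⟨n', μ'⟩ := by
  have hzero : ∀ {m : ℕ} (ν : m.Partition), m ≤ N → ∀ i, (i = 0 ∨ N < i) → ν.parts.count i = 0 := by
    intro m ν hm i hi
    refine Multiset.count_eq_zero_of_notMem fun hmem => ?_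
    have := ν.parts_pos hmem
    have := Nat.Partition.le_of_mem_parts hmem
    omega
  have hparts : μ.parts = μ'.parts := by
    ext i
    by_cases hi : i = 0 ∨ N < i
    · rw [hzero μ hn i hi, hzero μ' hn' i hi]
    · obtain ⟨j, rfl⟩ : ∃ j, i = j + 1 := ⟨i - 1, by omega⟩
      exact DFunLike.congr_fun h (⟨j, by omega⟩ : Fin N)
  have hnn : n = n' := by rw [← μ.parts_sum, ← μ'.parts_sum, hparts]
  subst hnn
  rw [Nat.Partition.ext hparts]

theorem elemPart_eq_prod {N n : ℕ} (μ : n.Partition) (hn : n ≤ N) :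
    elemPart μ = ∏ i : Fin N, elem (i + 1) ^ multiplicities N μ i := by
  classical
  rw [elemPart, Finset.prod_multiset_map_count]
  change _ = ∏ i : Fin N, elem (i + 1) ^ μ.parts.count (i + 1 : ℕ)
  rw [← Finset.prod_range fun i => elem (i + 1) ^ μ.parts.count (i + 1 : ℕ)]
  refine Eq.trans ?_ (Finset.prod_map (Finset.range N) ⟨Nat.succ, Nat.succ_injective⟩
    fun i => elem i ^ μ.parts.count i)
  refine Finset.prod_subset ?_ ?_
  · intro i hi
    rw [Multiset.mem_toFinset] at hi
    have := μ.parts_pos hi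
    have := Nat.Partition.le_of_mem_parts hi
    rw [Finset.mem_map]
    refine ⟨i - 1, Finset.mem_range.2 (by omega), ?_⟩
    change i - 1 + 1 = i
    omega
  · intro i _ hi
    rw [Multiset.mem_toFinset] at hi
    rw [Multiset.count_eq_zero_of_notMem hi, pow_zero]

/-- This turns a linear relation among the `elemPart μ` into a polynomial relation among elementary
symmetric polynomials, with one monomial per partition. -/
theorem killCompl_elemPart {N n : ℕ} (μ : n.Partition) (hn : n ≤ N) :
    MvPowerSeries.killCompl (R := ℤ) (Fin.valEmbedding (n := N)) (elemPart μ) =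
      ((MvPolynomial.esymmAlgHom (Fin N) ℤ N
        (MvPolynomial.monomial (multiplicities N μ) 1)).val : MvPowerSeries (Fin N) ℤ) := by
  rw [elemPart_eq_prod μ hn, map_prod, MvPolynomial.esymmAlgHom_apply,
    MvPolynomial.aeval_monomial, map_one, one_mul, Finsupp.prod_fintype _ _ fun _ => pow_zero _,
    ← MvPolynomial.coeToMvPowerSeries.ringHom_apply, map_prod]
  refine Finset.prod_congr rfl fun i _ => ?_
  rw [map_pow, map_pow, killCompl_elem, MvPolynomial.coeToMvPowerSeries.ringHom_apply]

/-- The elementary symmetric functions `e_μ` are linearly independent. -/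
theorem linearIndependent_elemPart :
    LinearIndependent ℤ fun μ : Σ n : ℕ, n.Partition => elemPart μ.2 := by
  classical
  rw [linearIndependent_iff]
  intro c hc
  -- The largest size that occurs: with `N` variables, all parts involved index algebraically
  -- independent elementary symmetric polynomials.
  let N := c.support.sup Sigma.fst
  have hN : ∀ μ ∈ c.support, μ.1 ≤ N := fun μ hμ => Finset.le_sup (f := Sigma.fst) hμ
  let p : MvPolynomial (Fin N) ℤ :=
    ∑ μ ∈ c.support, c μ • MvPolynomial.monomial (multiplicities N μ.2) 1
  have hp : p = 0 := by
    apply MvPolynomial.esymmAlgHom_fin_injective (m := N) (n := N) ℤ le_rfl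
    rw [map_zero]
    apply Subtype.ext
    apply MvPolynomial.coe_injective
    have h := congrArg (MvPowerSeries.killCompl (R := ℤ) (Fin.valEmbedding (n := N))) hc
    rw [map_zero, Finsupp.linearCombination_apply, Finsupp.sum, map_sum] at h
    change _ = ((0 : MvPolynomial (Fin N) ℤ) : MvPowerSeries (Fin N) ℤ)
    rw [MvPolynomial.coe_zero, ← h, ← MvPolynomial.coeToMvPowerSeries.ringHom_apply]
    rw [map_sum, AddSubmonoidClass.coe_finsetSum, map_sum]
    refine Finset.sum_congr rfl fun μ hμ => ?_
    rw [map_zsmul (MvPowerSeries.killCompl _), killCompl_elemPart μ.2 (hN μ hμ),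
      ← MvPolynomial.coeToMvPowerSeries.ringHom_apply,
      map_zsmul (MvPolynomial.esymmAlgHom (Fin N) ℤ N)]
    exact map_zsmul MvPolynomial.coeToMvPowerSeries.ringHom _ _
  ext μ
  by_contra hμ
  have hμ : μ ∈ c.support := Finsupp.mem_support_iff.2 hμ
  have h := congrArg (MvPolynomial.coeff (multiplicities N μ.2)) hp
  rw [MvPolynomial.coeff_zero, MvPolynomial.coeff_sum, Finset.sum_eq_single μ] at h
  · rw [MvPolynomial.coeff_smul, MvPolynomial.coeff_monomial, if_pos rfl] at h
    exact Finsupp.mem_support_iff.1 hμ (by simpa using h)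
  · intro ν hν hne
    rw [MvPolynomial.coeff_smul, MvPolynomial.coeff_monomial, if_neg, smul_zero]
    exact fun h' => hne (multiplicities_injective (hN ν hν) (hN μ hμ) h')
  · exact fun h' => absurd hμ h'

end Independence

/-! ### The determinantal expansion -/

section Expansion

variable (P : Type*) [PartialOrder P] [Fintype P]

open Classical in
/-- The determinantal expansion of the chromatic symmetric function of an incomparability graph. -/
theorem chromaticSymm_incGraph_eq_sum :
    chromaticSymm (incGraph P) = ∑ E : Digraph P with IsPathCover (weaklyDecreasing P) E,
      digraphDet (contraction (weaklyDecreasing P) E) • elemPart (digraphType E) := by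
  ext d
  rw [coeff_chromaticSymm, map_sum, Finset.card_filter, Nat.cast_sum]
  have hD : ∀ v w, (weaklyDecreasing P).Adj v w ↔ ¬ v < w := fun v w => Iff.rfl
  have hleft : ∀ κ : P → ℕ,
      (((if ∀ v w, κ v = κ w → ¬ (incGraph P).Adj v w then 1 else 0 : ℕ) : ℤ)) =
      ∑ E : Digraph P with IsPathCover (weaklyDecreasing P) E ∧ ∀ v w, E.Adj v w → κ v < κ w,
        digraphDet (contraction (weaklyDecreasing P) E) := by
    intro κ
    rw [← det_nonincreasing_eq_sum, det_not_lt_and_le P κ]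
    · rw [Nat.cast_ite, Nat.cast_one, Nat.cast_zero]
      refine if_congr ?_ rfl rfl
      refine forall_congr' fun v => forall_congr' fun w => imp_congr_right fun _ => ?_
      change ¬ (¬ v ≤ w ∧ ¬ w ≤ v) ↔ _
      tauto
    · intro v w h
      simp only [Matrix.of_apply, adjacencyMatrix, hD]
      split_ifs with h1 h2
      · rfl
      · rfl
      · exact absurd h (by tauto)
    · intro v w h1 h2
      simp only [Matrix.of_apply, adjacencyMatrix, hD]
      rw [if_neg h2.not_gt, if_pos h1]
  rw [Finset.sum_congr rfl fun κ _ => hleft κ]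
  simp only [← Finset.filter_filter, Finset.sum_filter _ (fun _ => digraphDet _)]
  -- After the exchange, each cover is weighted by the number of colourings increasing along it, a
  -- coefficient of its `elemPart`.
  rw [Finset.sum_comm]
  refine Finset.sum_congr rfl fun E hE => ?_
  rw [map_zsmul, coeff_elemPart_digraphType E (Finset.mem_filter.1 hE).2.2, ← Finset.sum_filter,
    Finset.sum_const, nsmul_eq_mul, smul_eq_mul, mul_comm]

end Expansion

end ChromaticDet

open ChromaticDet in
theorem mainTheorem2 (P : Type*) [PartialOrder P] [Fintype P] :
    (∃! c : (Σ n : ℕ, n.Partition) →₀ ℤ, IsElemExpansion (chromaticSymm (incGraph P)) c) ∧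
    ∀ c : (Σ n : ℕ, n.Partition) →₀ ℤ, IsElemExpansion (chromaticSymm (incGraph P)) c →
      ∀ (n : ℕ) (μ : n.Partition),
        c ⟨n, μ⟩ = ∑ E ∈ pathCovers (weaklyDecreasing P) μ,
          digraphDet (contraction (weaklyDecreasing P) E) := by
  classical
  let c₀ : (Σ n : ℕ, n.Partition) →₀ ℤ :=
    ∑ E : Digraph P with IsPathCover (weaklyDecreasing P) E,
      Finsupp.single ⟨Fintype.card P, digraphType E⟩
        (digraphDet (contraction (weaklyDecreasing P) E))
  have hc₀ : IsElemExpansion (chromaticSymm (incGraph P)) c₀ := by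
    have h : ∀ c : (Σ n : ℕ, n.Partition) →₀ ℤ, (c.sum fun μ a => a • elemPart μ.2) =
        Finsupp.linearCombination ℤ (fun μ : Σ n : ℕ, n.Partition => elemPart μ.2) c :=
      fun _ => rfl
    rw [IsElemExpansion, chromaticSymm_incGraph_eq_sum, h, map_sum]
    exact Finset.sum_congr rfl fun E _ => by rw [Finsupp.linearCombination_single]
  have huniq : ∀ c, IsElemExpansion (chromaticSymm (incGraph P)) c → c = c₀ := fun c hc =>
    linearIndependent_elemPart (hc.symm.trans hc₀)
  refine ⟨⟨c₀, hc₀, huniq⟩, fun c hc n μ => ?_⟩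
  rw [huniq c hc, Finsupp.finsetSum_apply, pathCovers, ← Finset.filter_filter,
    Finset.sum_filter _ (fun _ => digraphDet _)]
  refine Finset.sum_congr rfl fun E _ => ?_
  rw [Finsupp.single_apply]
  refine if_congr ?_ rfl rfl
  constructor
  · intro h
    cases h
    rfl
  · intro h
    -- `pathCovers` compares only multisets of parts, so the equality of sizes has to be recovered
    -- from their sums.
    have hn : n = Fintype.card P := by
      rw [← μ.parts_sum, ← h, (digraphType E).parts_sum]
    subst hn
    rw [Nat.Partition.ext h]
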